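/- Let $0<k<1$, $k'=\sqrt{1-k^2}$, $K=\int_0^{\pi/2}du/\sqrt{1-k^2\sin^2u}$, $K'=K(k')$, $\tau=iK'/K$, and let $\theta_1,\dots,\theta_4$ be the Jacobi theta functions with period $\tau$, where $\theta_3(z)=\sum_{n\in\mathbb Z}e^{i\pi(n^2\tau+2nz)}$, $\theta_4(z)=\theta_3(z+\tfrac12)$, $\theta_2(z)=e^{i\pi(\tau/4+z)}\theta_3(z+\tfrac{\tau}2)$, $\theta_1(z)=-\theta_2(z+\tfrac12)$. Let $(x_1,x_2,x_3)\in\mathbb R^3$, $x_4\in\mathbb R$, and let $P_j=(\zeta_j,\eta_j)$, $j=1,\dots,4$, be the four finite solutions (with multiplicity) of $$\eta=(x_2-ix_1)-2x_3\zeta-(x_2+ix_1)\zeta^2,\qquad 0=\eta^2+\tfrac{K^2}{4}\bigl(\zeta^4+2(k^2-k'^2)\zeta^2+1\bigr).$$ Let $\alpha_j=\frac14\int_{\infty_1}^{P_j}d\zeta/\eta$ be their Abel images, where $\infty_1$ is the point at infinity with $\eta/\zeta^2\to-iK/2$ and the paths on the curve are chosen so that $\alpha_1+\alpha_2+\alpha_3+\alpha_4=N\tau$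 with $N\in\mathbb Z$. Put $$\mu_j=\frac14\Bigl\{\frac{\theta_1'(\alpha_j)}{\theta_1(\alpha_j)}+\frac{\theta_3'(\alpha_j)}{\theta_3(\alpha_j)}\Bigr\}+i\pi N-i\bigl[(x_1-ix_2)\zeta_j-ix_3-x_4\bigr].$$ For $z\in(-1,1)$ let $f_3(z)=\frac{\pi\theta_2(0)\theta_4(0)}2\,\frac{\theta_4(z/2)}{\theta_2(z/2)}$, $F=\cosh\bigl(\tfrac12\int_0^zf_3\bigr)$, $G=\sinh\bigl(\tfrac12\int_0^zf_3\bigr)$, $C(z)=\begin{pmatrix}F&G\\G&F\end{pmatrix}$, $\mathcal O=\frac1{\sqrt2}\begin{pmatrix}1&-1\\1&1\end{pmatrix}$. For $i\in\{1,2,3,4\}$, with $(i,j,k,l)$ the cyclic permutation of $(1,2,3,4)$ starting at $i$ (as an index, $k$ is not the modulus), define $$\boldsymbol{\overline v}_i(z)=\bigl(1_2\otimes\mathcal O\,C^{-1}(z)\bigr)\frac{e^{-z\mu_i}}{\theta_2^2(z/2)}\left[\begin{pmatrix}-i\zeta_j\\1\end{pmatrix}\otimes\begin{pmatrix}A\\B\end{pmatrix}+\begin{pmatrix}1\\0\end{pmatrix}\otimes\begin{pmatrix}a\\b\end{pmatrix}\right],$$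 $$A=\frac{\theta_2(\frac z2)\,\theta_2(\alpha_j+\alpha_k+\alpha_l-\frac z2)}{\prod_{s\ne i}\theta_3(\alpha_s)},\qquad B=\frac{\theta_2(\frac z2)\,\theta_4(\alpha_j+\alpha_k+\alpha_l-\frac z2)}{\prod_{s\ne i}\theta_1(\alpha_s)},$$ $$\begin{pmatrix}a\\b\end{pmatrix}=\frac{\theta_2(0)\theta_4(0)\,\theta_3(\alpha_j+\alpha_k)\,\theta_3(\alpha_j+\alpha_l)\,\theta_4(\alpha_k+\alpha_l-\frac z2)}{\prod_{s\ne i}\theta_1(\alpha_s)\theta_3(\alpha_s)}\begin{pmatrix}\theta_4(\alpha_j-\frac z2)/\theta_3(\alpha_j)\\ \theta_2(\alpha_j-\frac z2)/\theta_1(\alpha_j)\end{pmatrix}.$$ Then for every $i$ there are unique vectors $\boldsymbol{\overline v}_{i,s}\in\mathbb C^4$, $s\ge0$, with $\boldsymbol{\overline v}_i(1-\xi)=\sum_{s\ge0}\boldsymbol{\overline v}_{i,s}\,\xi^{s-5/2}$ (convergent) for all sufficiently small $\xi>0$, and, again for all sufficiently small $\xi>0$, $$\boldsymbol{\overline v}_i(-1+\xi)=-\sum_{s\ge0}\boldsymbol{\overline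 v}_{i,s}'\,\xi^{s-5/2},\qquad \boldsymbol{\overline v}_{i,s}'=(-1)^s\,e^{2\mu_i}\left(1_2\otimes\begin{pmatrix}0&1\\-1&0\end{pmatrix}\right)\boldsymbol{\overline v}_{i,s}.$$ -/

import Mathlib

open scoped Kronecker Topology

noncomputable section

namespace Monopole

/-! ### Elliptic parameters and Jacobi theta functions -/

/-- The complete elliptic integral of the first kind, as a function of the modulus `k`. -/
def ellipticK (k : ℝ) : ℝ :=
  ∫ u in (0 : ℝ)..(Real.pi / 2), 1 / Real.sqrt (1 - k ^ 2 * Real.sin u ^ 2)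

/-- The complementary modulus `k'`. -/
def compl (k : ℝ) : ℝ := Real.sqrt (1 - k ^ 2)

/-- The period `τ = i K(k') / K(k)` of the spectral curve. -/
def tau (k : ℝ) : ℂ := Complex.I * (ellipticK (compl k) : ℂ) / (ellipticK k : ℂ)

/-- `θ₃(z) = ∑ₙ exp (iπ (n² τ + 2 n z))`. -/
def theta3 (k : ℝ) (z : ℂ) : ℂ := jacobiTheta₂ z (tau k)

/-- `θ₄(z) = ∑ₙ (-1)ⁿ exp (iπ (n² τ + 2 n z))`. -/
def theta4 (k : ℝ) (z : ℂ) : ℂ := jacobiTheta₂ (z + 1 / 2) (tau k)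

/-- `θ₂(z) = ∑ₙ exp (iπ ((n + 1/2)² τ + 2 (n + 1/2) z))`. -/
def theta2 (k : ℝ) (z : ℂ) : ℂ :=
  Complex.exp (Real.pi * Complex.I * (tau k / 4 + z)) * jacobiTheta₂ (z + tau k / 2) (tau k)

/-- `θ₁(z) = -i ∑ₙ (-1)ⁿ exp (iπ ((n + 1/2)² τ + 2 (n + 1/2) z))`, so that
`θ₂(z ± 1/2) = ∓ θ₁(z)`. -/
def theta1 (k : ℝ) (z : ℂ) : ℂ :=
  -Complex.I * Complex.exp (Real.pi * Complex.I * (tau k / 4 + z)) *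
    jacobiTheta₂ (z + (1 + tau k) / 2) (tau k)

/-! ### The spectral curve, the Atiyah-Ward equation and Abel images -/

/-- The polynomial `η² + (K²/4) (ζ⁴ + 2 (k² - k'²) ζ² + 1)` whose zero set is the spectral
curve of the charge two monopole. -/
def curvePoly (k : ℝ) (ζ η : ℂ) : ℂ :=
  η ^ 2 + (ellipticK k : ℂ) ^ 2 / 4 *
    (ζ ^ 4 + 2 * ((k : ℂ) ^ 2 - (compl k : ℂ) ^ 2) * ζ ^ 2 + 1)

/-- The mini-twistor correspondence: the value of `η` on the twistor line of the point
`(x₁, x₂, x₃)`. -/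
def twistorEta (x₁ x₂ x₃ : ℝ) (ζ : ℂ) : ℂ :=
  ((x₂ : ℂ) - Complex.I * x₁) - 2 * x₃ * ζ - ((x₂ : ℂ) + Complex.I * x₁) * ζ ^ 2

/-- The points `P_j = (ζ_j, η_j)`, `j = 1, …, 4`, are the four solutions, with multiplicity, of
the mini-twistor correspondence on the spectral curve: the `ζ_j` are the four (finite) roots of
the quartic Atiyah-Ward equation, whose leading coefficient is `K²/4 - (x₁ - i x₂)²`. -/
structure IsAtiyahWardSolution (k x₁ x₂ x₃ : ℝ) (ζ η : Fin 4 → ℂ) : Prop where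
  eta_eq : ∀ j, η j = twistorEta x₁ x₂ x₃ (ζ j)
  factor : ∀ w : ℂ, curvePoly k w (twistorEta x₁ x₂ x₃ w) =
    ((ellipticK k : ℂ) ^ 2 / 4 - ((x₁ : ℂ) - Complex.I * x₂) ^ 2) * ∏ j, (w - ζ j)

/-- `a` is an Abel image of the point `(ζ, η)` of the spectral curve: the integral of the
holomorphic differential `dζ / (4η)` along some path on the curve from `∞₁`, the point at
infinity where `η / ζ² → -i K / 2`, to `(ζ, η)`. The path `t ↦ (Z t, H t)`, `0 < t ≤ 1`, is
smooth and avoids the branch points, except perhaps at its end. -/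
def IsAbelImage (k : ℝ) (ζ η a : ℂ) : Prop :=
  ∃ Z H : ℝ → ℂ,
    ContinuousOn Z (Set.Ioc 0 1) ∧ ContinuousOn H (Set.Ioc 0 1) ∧
    (∀ t ∈ Set.Ioc (0 : ℝ) 1, curvePoly k (Z t) (H t) = 0) ∧
    ContDiffOn ℝ 1 Z (Set.Ioo 0 1) ∧ (∀ t ∈ Set.Ioo (0 : ℝ) 1, H t ≠ 0) ∧
    Filter.Tendsto (fun t => ‖Z t‖) (𝓝[>] 0) Filter.atTop ∧
    Filter.Tendsto (fun t => H t / Z t ^ 2) (𝓝[>] 0)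
      (𝓝 (-Complex.I * (ellipticK k : ℂ) / 2)) ∧
    Z 1 = ζ ∧ H 1 = η ∧
    IntervalIntegrable (fun t => deriv Z t / (4 * H t)) MeasureTheory.volume 0 1 ∧
    a = ∫ t in (0 : ℝ)..1, deriv Z t / (4 * H t)

/-- `β₁` as a function of the Abel image: `(θ₁'/θ₁ + θ₃'/θ₃) / 4`. -/
def beta1 (k : ℝ) (a : ℂ) : ℂ :=
  (deriv (theta1 k) a / theta1 k a + deriv (theta3 k) a / theta3 k a) / 4

/-- `μ = β₁ + iπN - i [(x₁ - i x₂) ζ - i x₃ - x₄]` for a point with coordinate `ζ` and Abel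
image `a`. -/
def mu (k x₁ x₂ x₃ x₄ : ℝ) (N : ℤ) (ζ a : ℂ) : ℂ :=
  beta1 k a + Complex.I * Real.pi * N -
    Complex.I * (((x₁ : ℂ) - Complex.I * x₂) * ζ - Complex.I * x₃ - x₄)

/-! ### Nahm data and the gauge transformation -/

/-- `f₃(z) = (π θ₂ θ₄ / 2) θ₄(z/2) / θ₂(z/2) = K k' / cn (K z)`. -/
def f3 (k : ℝ) (z : ℝ) : ℂ :=
  Real.pi * theta2 k 0 * theta4 k 0 / 2 * (theta4 k (z / 2) / theta2 k (z / 2))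

/-- `(1/2) ∫₀ᶻ f₃(s) ds`, for `z` in the interval `(-1, 1)`. -/
def halfInt (k : ℝ) (z : ℝ) : ℂ := (∫ s in (0 : ℝ)..z, f3 k s) / 2

/-- The gauge transformation `C(z) = [[F, G], [G, F]]` with `F = cosh (½ ∫₀ᶻ f₃)` and
`G = sinh (½ ∫₀ᶻ f₃)`. -/
def gaugeC (k : ℝ) (z : ℝ) : Matrix (Fin 2) (Fin 2) ℂ :=
  !![Complex.cosh (halfInt k z), Complex.sinh (halfInt k z);
     Complex.sinh (halfInt k z), Complex.cosh (halfInt k z)]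

/-- The orthogonal matrix `𝒪 = (1/√2) [[1, -1], [1, 1]]`. -/
def orthO : Matrix (Fin 2) (Fin 2) ℂ :=
  (1 / (Real.sqrt 2 : ℂ)) • !![1, -1; 1, 1]

/-! ### The solution columns -/

/-- The first entry `A` in `Λ̄ᵢ = (-i ζ_j, 1) ⊗ (A, B) + (1, 0) ⊗ (α, β)`; here and below `m` stands
for `μᵢ`, and `aj, ak, al` for the Abel images with the three indices different from `i`. -/
def colA (k : ℝ) (aj ak al m : ℂ) (z : ℂ) : ℂ :=
  theta2 k (z / 2) * theta2 k (aj + ak + al - z / 2) /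
    (theta3 k aj * theta3 k ak * theta3 k al) * Complex.exp (-z * m)

/-- The entry `B` of `Λ̄ᵢ`. -/
def colB (k : ℝ) (aj ak al m : ℂ) (z : ℂ) : ℂ :=
  theta2 k (z / 2) * theta4 k (aj + ak + al - z / 2) /
    (theta1 k aj * theta1 k ak * theta1 k al) * Complex.exp (-z * m)

/-- The entry `α` of `Λ̄ᵢ`. -/
def colAlpha (k : ℝ) (aj ak al m : ℂ) (z : ℂ) : ℂ :=
  theta2 k 0 * theta4 k 0 * theta3 k (aj + ak) * theta3 k (aj + al) *
      theta4 k (aj - z / 2) * theta4 k (ak + al - z / 2) /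
    (theta3 k aj *
      ((theta1 k aj * theta3 k aj) * (theta1 k ak * theta3 k ak) * (theta1 k al * theta3 k al))) *
    Complex.exp (-z * m)

/-- The entry `β` of `Λ̄ᵢ`. -/
def colBeta (k : ℝ) (aj ak al m : ℂ) (z : ℂ) : ℂ :=
  theta2 k 0 * theta4 k 0 * theta3 k (aj + ak) * theta3 k (aj + al) *
      theta2 k (aj - z / 2) * theta4 k (ak + al - z / 2) /
    (theta1 k aj *
      ((theta1 k aj * theta3 k aj) * (theta1 k ak * theta3 k ak) * (theta1 k al * theta3 k al))) *
    Complex.exp (-z * m)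

/-- The vector `Λ̄ᵢ(z)`, with `(i, j, k, l)` the cyclic permutation of the four labels that starts
at `i`. A vector of `ℂ² ⊗ ℂ² = ℂ⁴` is indexed by `Fin 2 × Fin 2`, in lexicographic order. -/
def lambdaBar (k x₁ x₂ x₃ x₄ : ℝ) (N : ℤ) (ζ a : Fin 4 → ℂ) (i : Fin 4) (z : ℂ) :
    Fin 2 × Fin 2 → ℂ := fun p =>
  let m := mu k x₁ x₂ x₃ x₄ N (ζ i) (a i)
  let aj := a (i + 1)
  let ak := a (i + 2)
  let al := a (i + 3)
  (![-Complex.I * ζ (i + 1), 1] : Fin 2 → ℂ) p.1 *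
      (![colA k aj ak al m z, colB k aj ak al m z] : Fin 2 → ℂ) p.2 +
    (![1, 0] : Fin 2 → ℂ) p.1 *
      (![colAlpha k aj ak al m z, colBeta k aj ak al m z] : Fin 2 → ℂ) p.2

/-- The solution column `v̄ᵢ(z) = (1₂ ⊗ 𝒪 C(z)⁻¹) θ₂(z/2)⁻² Λ̄ᵢ(z)`, for `z` in `(-1, 1)`. -/
def vBar (k x₁ x₂ x₃ x₄ : ℝ) (N : ℤ) (ζ a : Fin 4 → ℂ) (i : Fin 4) (z : ℝ) :
    Fin 2 × Fin 2 → ℂ :=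
  ((1 : Matrix (Fin 2) (Fin 2) ℂ) ⊗ₖ (orthO * (gaugeC k z)⁻¹)).mulVec
    ((1 / theta2 k (z / 2) ^ 2) • lambdaBar k x₁ x₂ x₃ x₄ N ζ a i z)

/-- `U = 1₂ ⊗ [[0, 1], [-1, 0]]`. -/
def matU : Matrix (Fin 2 × Fin 2) (Fin 2 × Fin 2) ℂ :=
  (1 : Matrix (Fin 2) (Fin 2) ℂ) ⊗ₖ !![0, 1; -1, 0]

/-- The convergent expansion `f(ξ) = ∑_{s ≥ 0} c_s ξ^(s - 5/2)` for all small `ξ > 0`. -/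
def HasPoleExpansion (f : ℝ → Fin 2 × Fin 2 → ℂ) (c : ℕ → Fin 2 × Fin 2 → ℂ) : Prop :=
  ∀ᶠ ξ in 𝓝[>] (0 : ℝ),
    HasSum (fun s : ℕ => ((ξ ^ ((s : ℝ) - 5 / 2) : ℝ) : ℂ) • c s) (f ξ)

end Monopole

end

open scoped Kronecker Topology

noncomputable section

namespace Monopole

/-! ### Infinite products -/

/-! The gauge matrix diagonalises. With `h = halfInt`, the rows of `𝒪 C⁻¹` are `e^h (1, -1)` and
`e^{-h} (1, 1)`, up to `1/√2`. Each pair of entries of the column is thus `θ₂(z/2)⁻²` times `e^h (L₀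
- L₁)` and `e^{-h} (L₀ + L₁)`, where `L = lambdaBar` is entire in `z`.

At `z = 1 - ξ`, `θ₂(z/2) = θ₁(ξ/2) = ξ S(ξ)` with `S` even and `S(0) ≠ 0`. Also `ξ f₃(1 - ξ)` is
even and equals `1` at `ξ = 0`; this normalisation is Jacobi's formula `θ₁'(0) = π θ₂ θ₃ θ₄`
(`hasDerivAt_theta1_zero`), which follows from the triple product. Integration gives `e^h = ξ^(-1/2)
g(ξ)` with `g` analytic, even and without zeros (`exists_exp_halfInt`). Hence the column is
`ξ^(-5/2) Φ(ξ)` with `Φ` analytic (`columnGerm`), and its power series is the unique expansion.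

At `z = -1 + ξ`, `h` is odd and `θ₂` even, so `e^h` and `e^{-h}` trade places. The shift `z ↦ z + 2`
multiplies `L₀`, `L₁` by `e^{-2μ}`, `-e^{-2μ}` (`lambdaBar_eq_add_two`), so `L₀ ± L₁` trade places
too, now evaluated at `1 - (-ξ)`. As `S` and `g` are even, the column equals `-e^{2μ} ξ^(-5/2) U
Φ(-ξ)`; the signs `(-1)^s` come from `Φ(-ξ)`. -/

/-- The infinite product `∏ (1 + Q ^ n w)`, that is, the `q`-Pochhammer symbol `(-w; Q)_∞`. -/
def qProd (Q w : ℂ) : ℂ := ∏' n : ℕ, (1 + Q ^ n * w)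

lemma summable_norm_pow_mul {Q : ℂ} (hQ : ‖Q‖ < 1) (w : ℂ) :
    Summable fun n : ℕ => ‖Q ^ n * w‖ := by
  simpa using (summable_geometric_of_lt_one (norm_nonneg _) hQ).mul_right ‖w‖

lemma multipliable_qProd {Q : ℂ} (hQ : ‖Q‖ < 1) (w : ℂ) :
    Multipliable fun n : ℕ => 1 + Q ^ n * w :=
  multipliable_one_add_of_summable (summable_norm_pow_mul hQ w)

lemma tendsto_prod_qProd {Q : ℂ} (hQ : ‖Q‖ < 1) (w : ℂ) :
    Filter.Tendsto (fun N => ∏ n ∈ Finset.range N, (1 + Q ^ n * w)) Filter.atTop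
      (𝓝 (qProd Q w)) :=
  (multipliable_qProd hQ w).hasProd.tendsto_prod_nat

lemma qProd_eq {Q : ℂ} (hQ : ‖Q‖ < 1) (w : ℂ) : qProd Q w = (1 + w) * qProd Q (Q * w) := by
  refine tendsto_nhds_unique
    ((Filter.tendsto_add_atTop_iff_nat 1).2 (tendsto_prod_qProd hQ w)) ?_
  have h := (tendsto_prod_qProd hQ (Q * w)).const_mul (1 + w)
  refine h.congr fun N => ?_
  rw [Finset.prod_range_succ']
  simp only [pow_succ, pow_zero, one_mul, mul_assoc]
  ring

lemma qProd_ne_zero {Q : ℂ} (hQ : ‖Q‖ < 1) {w : ℂ} (hw : ∀ n : ℕ, 1 + Q ^ n * w ≠ 0) :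
    qProd Q w ≠ 0 :=
  tprod_one_add_ne_zero_of_summable hw (summable_norm_pow_mul hQ w)

lemma qProd_ne_zero_of_norm_lt {Q : ℂ} (hQ : ‖Q‖ < 1) {w : ℂ} (hw : ‖w‖ < 1) :
    qProd Q w ≠ 0 := by
  refine qProd_ne_zero hQ fun n h => ?_
  have h1 : ‖Q ^ n * w‖ < 1 := by
    rw [norm_mul, norm_pow]
    calc ‖Q‖ ^ n * ‖w‖ ≤ 1 * ‖w‖ := by
          gcongr
          exact pow_le_one₀ (norm_nonneg _) hQ.le
      _ < 1 := by simpa using hw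
  rw [eq_neg_of_add_eq_zero_right h] at h1
  simp at h1

lemma continuous_qProd {Q : ℂ} (hQ : ‖Q‖ < 1) : Continuous (qProd Q) := by
  refine continuous_iff_continuousAt.2 fun w₀ => ?_
  refine tendsto_tprod_one_add_of_dominated_convergence
    (bound := fun n : ℕ => ‖Q‖ ^ n * (‖w₀‖ + 1))
    ((summable_geometric_of_lt_one (norm_nonneg _) hQ).mul_right _) (fun n => ?_) ?_
  · exact (continuous_const.mul continuous_id).tendsto w₀
  · have : ∀ᶠ w in 𝓝 w₀, ‖w‖ < ‖w₀‖ + 1 :=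
      continuous_norm.continuousAt.eventually_lt continuousAt_const (by simp)
    filter_upwards [this] with w hw n
    rw [norm_mul, norm_pow]
    gcongr

/-- Euler's identity, in the form `∏ (1 + q²ⁿ⁺²) (1 + q²ⁿ⁺¹) (1 - q²ⁿ⁺¹) = 1`. -/
lemma qProd_mul_qProd_mul_qProd {q : ℂ} (hq : ‖q‖ < 1) :
    qProd (q ^ 2) (q ^ 2) * qProd (q ^ 2) q * qProd (q ^ 2) (-q) = 1 := by
  set Q := q ^ 2 with hQdef
  have hQ : ‖Q‖ < 1 := by rw [hQdef, norm_pow]; exact pow_lt_one₀ (norm_nonneg _) hq two_ne_zero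
  have hP : qProd Q (-Q) ≠ 0 := qProd_ne_zero_of_norm_lt hQ (by simpa using hQ)
  have h1 : Filter.Tendsto (fun N => ∏ n ∈ Finset.range (2 * N), (1 + Q ^ n * (-Q))) Filter.atTop
      (𝓝 (qProd Q (-Q))) :=
    (tendsto_prod_qProd hQ (-Q)).comp (Filter.tendsto_id.const_mul_atTop' two_pos)
  have h2 := ((((tendsto_prod_qProd hQ (-Q)).mul (tendsto_prod_qProd hQ Q)).mul
    (tendsto_prod_qProd hQ q)).mul (tendsto_prod_qProd hQ (-q)))
  -- Difference of squares: even exponents give `1 - Q^(2m) = (1 - Q^m)(1 + Q^m)`, odd ones `1 -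
  -- Q^(2m+1) = (1 - q^(2m+1))(1 + q^(2m+1))`.
  have h3 : ∀ N, ∏ n ∈ Finset.range (2 * N), (1 + Q ^ n * (-Q)) =
      (∏ n ∈ Finset.range N, (1 + Q ^ n * (-Q))) * (∏ n ∈ Finset.range N, (1 + Q ^ n * Q)) *
      (∏ n ∈ Finset.range N, (1 + Q ^ n * q)) * (∏ n ∈ Finset.range N, (1 + Q ^ n * (-q))) := by
    intro N
    induction N with
    | zero => simp
    | succ N ih =>
      rw [show 2 * (N + 1) = 2 * N + 1 + 1 by ring, Finset.prod_range_succ, Finset.prod_range_succ,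
        ih]
      simp only [Finset.prod_range_succ]
      rw [hQdef]
      ring
  have h4 := tendsto_nhds_unique h1 (h2.congr fun N => (h3 N).symm)
  apply mul_left_cancel₀ hP
  rw [mul_one]
  conv_rhs => rw [h4]
  ring

/-! ### The Jacobi triple product -/

/-- The reciprocal of `(Q; Q)_n`, extended by zero to negative `n`. -/
def invPoch (Q : ℂ) : ℤ → ℂ
  | Int.ofNat n => (∏ i ∈ Finset.range n, (1 + Q ^ i * (-Q)))⁻¹
  | Int.negSucc _ => 0

lemma one_sub_pow_succ_ne_zero {Q : ℂ} (hQ : ‖Q‖ < 1) (n : ℕ) : 1 + Q ^ n * (-Q) ≠ 0 := by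
  intro h
  have h1 : Q ^ (n + 1) = 1 := by linear_combination -h
  have h2 : ‖Q‖ ^ (n + 1) < 1 := pow_lt_one₀ (norm_nonneg _) hQ n.succ_ne_zero
  rw [← norm_pow, h1] at h2
  simp at h2

/-- The extension by zero is what makes this recursion hold for every integer: at `n = 0` the factor
`1 - Q^0` vanishes. No boundary cases then arise in the finite triple product. -/
lemma invPoch_pred {Q : ℂ} (hQ : ‖Q‖ < 1) (n : ℤ) :
    invPoch Q (n - 1) = (1 - Q ^ n) * invPoch Q n := by
  obtain ⟨n, rfl | rfl⟩ := n.eq_nat_or_neg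
  · cases n with
    | zero => simp [show invPoch Q (-1) = 0 from rfl]
    | succ n =>
      have h : ((n + 1 : ℕ) : ℤ) - 1 = Int.ofNat n := by simp
      rw [h]
      change (∏ i ∈ Finset.range n, (1 + Q ^ i * (-Q)))⁻¹ =
        _ * (∏ i ∈ Finset.range (n + 1), (1 + Q ^ i * (-Q)))⁻¹
      rw [Finset.prod_range_succ, mul_inv, zpow_natCast]
      have h1 : 1 - Q ^ (n + 1) = 1 + Q ^ n * (-Q) := by ring
      rw [h1, mul_comm _ (_⁻¹ * _), mul_assoc, inv_mul_cancel₀ (one_sub_pow_succ_ne_zero hQ n),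
        mul_one]
  · cases n with
    | zero => simp [show invPoch Q (-1) = 0 from rfl]
    | succ n =>
      have h : (-((n + 1 : ℕ) : ℤ)) - 1 = Int.negSucc (n + 1) := by
        rw [Int.negSucc_eq]; push_cast; ring
      have h' : (-((n + 1 : ℕ) : ℤ)) = Int.negSucc n := by rw [Int.negSucc_eq]; push_cast; ring
      rw [h, h']
      simp [invPoch]

/-- The finite form of the Jacobi triple product. -/
lemma hasSum_finite_triple_product {q : ℂ} (hq0 : q ≠ 0) (hq : ‖q‖ < 1) {w : ℂ} (hw : w ≠ 0)
    (N : ℕ) :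
    HasSum (fun m : ℤ => (∏ i ∈ Finset.range (2 * N), (1 + (q ^ 2) ^ i * (-q ^ 2))) *
        invPoch (q ^ 2) (N - m) * invPoch (q ^ 2) (N + m) * (q ^ (m ^ 2) * w ^ m))
      ((∏ n ∈ Finset.range N, (1 + (q ^ 2) ^ n * (q * w))) *
        ∏ n ∈ Finset.range N, (1 + (q ^ 2) ^ n * (q * w⁻¹))) := by
  have hQ : ‖q ^ 2‖ < 1 := by rw [norm_pow]; exact pow_lt_one₀ (norm_nonneg _) hq two_ne_zero
  induction N with
  | zero =>
    have h0 : invPoch (q ^ 2) 0 = 1 := by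
      change (∏ i ∈ Finset.range 0, _)⁻¹ = (1 : ℂ)
      simp
    convert hasSum_single (0 : ℤ) ?_ using 1
    · simp [h0]
    · intro m hm
      rcases lt_or_gt_of_ne hm with hm | hm
      · obtain ⟨n, rfl⟩ := Int.eq_negSucc_of_lt_zero hm
        simp [invPoch]
      · obtain ⟨n, hn⟩ := Int.eq_negSucc_of_lt_zero (neg_lt_zero.2 hm)
        simp [hn, invPoch]
  | succ N ih =>
    have hp := (Equiv.addRight (1 : ℤ)).hasSum_iff.2 ih
    have hm := (Equiv.addRight (-1 : ℤ)).hasSum_iff.2 ih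
    -- The coefficients are Gaussian binomials in `q²`. The two new factors multiply to `1 +
    -- q^(4N+2) + q^(2N+1) w + q^(2N+1) w⁻¹`, and multiplication by `w^{±1}` shifts the summation
    -- index.
    have key := ((ih.mul_left (1 + q ^ (4 * N + 2))).add
      (hm.mul_left (q ^ (2 * N + 1) * w))).add (hp.mul_left (q ^ (2 * N + 1) * w⁻¹))
    refine (congrArg₂ (fun (f : ℤ → ℂ) s => HasSum f s) (funext fun m => ?_) ?_).mpr key
    · simp only [Function.comp_apply, Equiv.coe_addRight]
      set P := ∏ i ∈ Finset.range (2 * N), (1 + (q ^ 2) ^ i * (-q ^ 2)) with hPdef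
      rw [show 2 * (N + 1) = 2 * N + 1 + 1 by ring, Finset.prod_range_succ, Finset.prod_range_succ,
        ← hPdef]
      have hq2 : q ^ 2 ≠ 0 := pow_ne_zero _ hq0
      set R := invPoch (q ^ 2) with hR
      set a : ℤ := N - m with ha
      set b : ℤ := N + m with hb
      have ra : R a = (1 - (q ^ 2) ^ (a + 1)) * R (a + 1) := by
        rw [hR, ← invPoch_pred hQ]; simp
      have rb : R b = (1 - (q ^ 2) ^ (b + 1)) * R (b + 1) := by
        rw [hR, ← invPoch_pred hQ]; simp
      have ra' : R (a - 1) = (1 - (q ^ 2) ^ a) * R a := by rw [hR, ← invPoch_pred hQ]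
      have rb' : R (b - 1) = (1 - (q ^ 2) ^ b) * R b := by rw [hR, ← invPoch_pred hQ]
      rw [show ((N + 1 : ℕ) : ℤ) - m = a + 1 by push_cast; ring,
        show ((N + 1 : ℕ) : ℤ) + m = b + 1 by push_cast; ring,
        show (N : ℤ) - (m + -1) = a + 1 by ring, show (N : ℤ) + (m + -1) = b - 1 by ring,
        show (N : ℤ) - (m + 1) = a - 1 by ring, show (N : ℤ) + (m + 1) = b + 1 by ring,
        ra', rb', ra, rb, zpow_add₀ hq2, zpow_add₀ hq2]
      have e1 : q ^ ((m + -1) ^ 2) * w ^ (m + -1) * (q ^ (2 * N + 1) * w) =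
          (q ^ 2) ^ a * q ^ 2 * (q ^ (m ^ 2) * w ^ m) := by
        rw [zpow_add₀ hw, show (q ^ (2 * N + 1) : ℂ) = q ^ ((2 * N + 1 : ℕ) : ℤ) from
          (zpow_natCast _ _).symm, show ((q ^ 2) ^ a * q ^ 2 : ℂ) = q ^ (2 * a + 2) by
          rw [zpow_add₀ hq0, zpow_mul]; norm_cast]
        have : q ^ ((m + -1) ^ 2) * q ^ ((2 * N + 1 : ℕ) : ℤ) = q ^ (2 * a + 2) * q ^ (m ^ 2) := by
          rw [← zpow_add₀ hq0, ← zpow_add₀ hq0]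
          congr 1
          rw [ha]; push_cast; ring
        calc _ = (q ^ ((m + -1) ^ 2) * q ^ ((2 * N + 1 : ℕ) : ℤ)) * w ^ m * (w ^ (-1 : ℤ) * w) := by
              ring
          _ = _ := by rw [this, zpow_neg_one, inv_mul_cancel₀ hw]; ring
      have e2 : q ^ ((m + 1) ^ 2) * w ^ (m + 1) * (q ^ (2 * N + 1) * w⁻¹) =
          (q ^ 2) ^ b * q ^ 2 * (q ^ (m ^ 2) * w ^ m) := by
        rw [zpow_add₀ hw, show (q ^ (2 * N + 1) : ℂ) = q ^ ((2 * N + 1 : ℕ) : ℤ) from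
          (zpow_natCast _ _).symm, show ((q ^ 2) ^ b * q ^ 2 : ℂ) = q ^ (2 * b + 2) by
          rw [zpow_add₀ hq0, zpow_mul]; norm_cast]
        have : q ^ ((m + 1) ^ 2) * q ^ ((2 * N + 1 : ℕ) : ℤ) = q ^ (2 * b + 2) * q ^ (m ^ 2) := by
          rw [← zpow_add₀ hq0, ← zpow_add₀ hq0]
          congr 1
          rw [hb]; push_cast; ring
        calc _ = (q ^ ((m + 1) ^ 2) * q ^ ((2 * N + 1 : ℕ) : ℤ)) * w ^ m * (w ^ (1 : ℤ) * w⁻¹) := by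
              ring
          _ = _ := by rw [this, zpow_one, mul_inv_cancel₀ hw]; ring
      have e3 : (q ^ 2) ^ a * (q ^ 2) ^ b = q ^ (4 * N) := by
        rw [← zpow_add₀ hq2, show a + b = ((2 * N : ℕ) : ℤ) by rw [ha, hb]; push_cast; ring,
          zpow_natCast, ← pow_mul]
        ring_nf
      set X := (q ^ 2) ^ a
      set Y := (q ^ 2) ^ b
      set T := q ^ (m ^ 2) * w ^ m
      have f1 : ∀ r : ℂ, q ^ (2 * N + 1) * w * (r * (q ^ ((m + -1) ^ 2) * w ^ (m + -1))) =
          r * (X * q ^ 2 * T) := fun r => by rw [← e1]; ring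
      have f2 : ∀ r : ℂ, q ^ (2 * N + 1) * w⁻¹ * (r * (q ^ ((m + 1) ^ 2) * w ^ (m + 1))) =
          r * (Y * q ^ 2 * T) := fun r => by rw [← e2]; ring
      rw [f1, f2, show q ^ (4 * N + 2) = X * Y * q ^ 2 by rw [e3]; ring,
        show (q ^ 2) ^ (2 * N) = X * Y by rw [e3]; ring,
        show (q ^ 2) ^ (2 * N + 1) = X * Y * q ^ 2 by rw [e3]; ring]
      simp only [zpow_one]
      ring
    · rw [Finset.prod_range_succ, Finset.prod_range_succ]
      have : w * w⁻¹ = 1 := mul_inv_cancel₀ hw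
      linear_combination ((∏ n ∈ Finset.range N, (1 + (q ^ 2) ^ n * (q * w))) *
        ∏ n ∈ Finset.range N, (1 + (q ^ 2) ^ n * (q * w⁻¹))) * (q ^ 2) ^ (2 * N) * q ^ 2 * this

lemma tendsto_invPoch {Q : ℂ} (hQ : ‖Q‖ < 1) (m : ℤ) :
    Filter.Tendsto (fun N : ℕ => invPoch Q (N + m)) Filter.atTop (𝓝 (qProd Q (-Q))⁻¹) := by
  have hP : qProd Q (-Q) ≠ 0 := qProd_ne_zero_of_norm_lt hQ (by simpa using hQ)
  have h := (tendsto_prod_qProd hQ (-Q)).inv₀ hP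
  have h2 : Filter.Tendsto (fun N : ℕ => ((N : ℤ) + m).toNat) Filter.atTop Filter.atTop := by
    refine Filter.tendsto_atTop.2 fun b => ?_
    filter_upwards [Filter.eventually_ge_atTop (b + m.natAbs)] with N hN
    omega
  refine (h.comp h2).congr' ?_
  filter_upwards [Filter.eventually_ge_atTop m.natAbs] with N hN
  obtain ⟨n, hn⟩ := Int.eq_ofNat_of_zero_le (a := (N : ℤ) + m) (by omega)
  simp only [Function.comp_apply, hn]
  rfl

/-- Uniformity in `n` provides the dominating function when `N → ∞` under the sum over `m`. -/
lemma exists_norm_invPoch_le {Q : ℂ} (hQ : ‖Q‖ < 1) : ∃ C, ∀ n, ‖invPoch Q n‖ ≤ C := by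
  obtain ⟨C, hC⟩ := (Metric.isBounded_range_of_tendsto _ (tendsto_invPoch hQ 0)).exists_norm_le
  refine ⟨C, fun n => ?_⟩
  rcases n with n | n
  · exact hC _ ⟨n, by simp⟩
  · exact (norm_nonneg _).trans (hC _ ⟨0, rfl⟩) |>.trans' (by simp [invPoch])

/-- The Jacobi triple product identity. -/
theorem jacobi_triple_product {q : ℂ} (hq0 : q ≠ 0) (hq : ‖q‖ < 1) {w : ℂ} (hw : w ≠ 0)
    (hs : Summable fun m : ℤ => ‖q ^ (m ^ 2) * w ^ m‖) :
    ∑' m : ℤ, q ^ (m ^ 2) * w ^ m =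
      qProd (q ^ 2) (-q ^ 2) * qProd (q ^ 2) (q * w) * qProd (q ^ 2) (q * w⁻¹) := by
  have hQ : ‖q ^ 2‖ < 1 := by rw [norm_pow]; exact pow_lt_one₀ (norm_nonneg _) hq two_ne_zero
  have hP : qProd (q ^ 2) (-q ^ 2) ≠ 0 := qProd_ne_zero_of_norm_lt hQ (by simpa using hQ)
  obtain ⟨C, hC⟩ := exists_norm_invPoch_le hQ
  have hC0 : 0 ≤ C := (norm_nonneg _).trans (hC 0)
  have hN2 : Filter.Tendsto (fun N => ∏ n ∈ Finset.range (2 * N), (1 + (q ^ 2) ^ n * (-q ^ 2)))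
      Filter.atTop (𝓝 (qProd (q ^ 2) (-q ^ 2))) :=
    (tendsto_prod_qProd hQ (-q ^ 2)).comp (Filter.tendsto_id.const_mul_atTop' two_pos)
  obtain ⟨D, hD⟩ := (Metric.isBounded_range_of_tendsto _ hN2).exists_norm_le
  have hD0 : 0 ≤ D := (norm_nonneg _).trans (hD _ ⟨0, rfl⟩)
  have key := tendsto_tsum_of_dominated_convergence (𝓕 := Filter.atTop)
    (f := fun (N : ℕ) (m : ℤ) => (∏ i ∈ Finset.range (2 * N), (1 + (q ^ 2) ^ i * (-q ^ 2))) *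
        invPoch (q ^ 2) (N - m) * invPoch (q ^ 2) (N + m) * (q ^ (m ^ 2) * w ^ m))
    -- The three Pochhammer limits combine to the single constant `1 / (Q; Q)_∞`.
    (g := fun m => qProd (q ^ 2) (-q ^ 2) * (qProd (q ^ 2) (-q ^ 2))⁻¹ *
      (qProd (q ^ 2) (-q ^ 2))⁻¹ * (q ^ (m ^ 2) * w ^ m))
    (hs.mul_left (D * C * C))
    (fun m => ((hN2.mul (by simpa [sub_eq_add_neg] using tendsto_invPoch hQ (-m))).mul
      (tendsto_invPoch hQ m)).mul_const _)
    (.of_forall fun N m => by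
      rw [norm_mul, norm_mul, norm_mul]
      gcongr
      · exact hD _ ⟨N, rfl⟩
      · exact hC _
      · exact hC _)
  simp only [fun N => (hasSum_finite_triple_product hq0 hq hw N).tsum_eq] at key
  rw [tsum_mul_left] at key
  have := tendsto_nhds_unique key
    ((tendsto_prod_qProd hQ (q * w)).mul (tendsto_prod_qProd hQ (q * w⁻¹)))
  rw [mul_assoc, ← this]
  field_simp

/-! ### Product formulas and symmetries of the theta functions -/

lemma jacobiTheta₂_eq_qProd (z : ℂ) {τ : ℂ} (hτ : 0 < τ.im) :
    jacobiTheta₂ z τ =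
      qProd (Complex.exp (Real.pi * Complex.I * τ) ^ 2) (-Complex.exp (Real.pi * Complex.I * τ) ^ 2) *
      qProd (Complex.exp (Real.pi * Complex.I * τ) ^ 2)
        (Complex.exp (Real.pi * Complex.I * τ) * Complex.exp (2 * Real.pi * Complex.I * z)) *
      qProd (Complex.exp (Real.pi * Complex.I * τ) ^ 2)
        (Complex.exp (Real.pi * Complex.I * τ) * (Complex.exp (2 * Real.pi * Complex.I * z))⁻¹) := by
  have hterm : ∀ m : ℤ, jacobiTheta₂_term m z τ = Complex.exp (Real.pi * Complex.I * τ) ^ (m ^ 2) *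
      Complex.exp (2 * Real.pi * Complex.I * z) ^ m := by
    intro m
    rw [← Complex.exp_int_mul, ← Complex.exp_int_mul, ← Complex.exp_add, jacobiTheta₂_term]
    congr 1
    push_cast
    ring
  have hq : ‖Complex.exp (Real.pi * Complex.I * τ)‖ < 1 := by
    rw [Complex.norm_exp, Real.exp_lt_one_iff]
    simpa using mul_pos Real.pi_pos hτ
  rw [← jacobi_triple_product (Complex.exp_ne_zero _) hq (Complex.exp_ne_zero _)]
  · exact tsum_congr hterm
  · simpa only [hterm] using ((summable_jacobiTheta₂_term_iff z τ).2 hτ).norm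

lemma ellipticK_pos {k : ℝ} (hk : k ^ 2 < 1) : 0 < ellipticK k := by
  have hpos : ∀ u : ℝ, 0 < 1 - k ^ 2 * Real.sin u ^ 2 := fun u => by
    nlinarith [Real.sin_sq_le_one u, sq_nonneg k, sq_nonneg (Real.sin u)]
  refine intervalIntegral.intervalIntegral_pos_of_pos ?_
    (fun u => by have := hpos u; positivity) (by positivity)
  refine Continuous.intervalIntegrable ?_ _ _
  refine continuous_const.div (by fun_prop) fun u => (Real.sqrt_pos.2 (hpos u)).ne'

lemma tau_im_pos {k : ℝ} (hk0 : 0 < k) (hk1 : k < 1) : 0 < (tau k).im := by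
  have h1 : 0 < ellipticK k := ellipticK_pos (by nlinarith)
  have h2 : 0 < ellipticK (compl k) := ellipticK_pos (by
    rw [compl, Real.sq_sqrt (by nlinarith)]; nlinarith)
  have : tau k = ((ellipticK (compl k) / ellipticK k : ℝ) : ℂ) * Complex.I := by
    rw [tau]; push_cast; ring
  rw [this, Complex.im_ofReal_mul, Complex.I_im, mul_one]
  positivity

variable (k : ℝ)

lemma theta3_neg (z : ℂ) : theta3 k (-z) = theta3 k z := jacobiTheta₂_neg_left _ _

lemma theta4_add_one (z : ℂ) : theta4 k (z + 1) = theta4 k z := by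
  rw [theta4, theta4, ← jacobiTheta₂_add_left (z + 1 / 2)]
  ring_nf

lemma theta4_neg (z : ℂ) : theta4 k (-z) = theta4 k z := by
  rw [theta4, theta4, ← jacobiTheta₂_neg_left, ← jacobiTheta₂_add_left]
  ring_nf

lemma theta4_half_sub (z : ℂ) : theta4 k (1 / 2 - z) = theta3 k z := by
  rw [theta4, theta3, ← jacobiTheta₂_neg_left z, ← jacobiTheta₂_add_left (-z)]
  ring_nf

lemma theta2_add_one (z : ℂ) : theta2 k (z + 1) = -theta2 k z := by
  rw [theta2, theta2, show z + 1 + tau k / 2 = z + tau k / 2 + 1 by ring, jacobiTheta₂_add_left,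
    show Real.pi * Complex.I * (tau k / 4 + (z + 1)) =
      Real.pi * Complex.I * (tau k / 4 + z) + Real.pi * Complex.I by ring, Complex.exp_add,
    Complex.exp_pi_mul_I]
  ring

lemma theta2_neg (z : ℂ) : theta2 k (-z) = theta2 k z := by
  rw [theta2, theta2, show z + tau k / 2 = (z - tau k / 2) + tau k by ring, jacobiTheta₂_add_left',
    ← jacobiTheta₂_neg_left (-z + tau k / 2), ← mul_assoc, ← Complex.exp_add]
  ring_nf

lemma theta1_eq_theta2 (z : ℂ) : theta1 k z = theta2 k (z - 1 / 2) := by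
  rw [theta1, theta2, show z + (1 + tau k) / 2 = z - 1 / 2 + tau k / 2 + 1 by ring,
    jacobiTheta₂_add_left, show Real.pi * Complex.I * (tau k / 4 + (z - 1 / 2)) =
      Real.pi * Complex.I * (tau k / 4 + z) + -(Real.pi / 2 * Complex.I) by ring, Complex.exp_add,
    Complex.exp_neg, Complex.exp_pi_div_two_mul_I, Complex.inv_I]
  ring

lemma theta2_half_sub (z : ℂ) : theta2 k (1 / 2 - z) = theta1 k z := by
  rw [theta1_eq_theta2, ← theta2_neg]
  ring_nf

lemma theta1_neg (z : ℂ) : theta1 k (-z) = -theta1 k z := by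
  rw [theta1_eq_theta2, theta1_eq_theta2, ← theta2_add_one, ← theta2_neg]
  ring_nf

lemma theta1_zero : theta1 k 0 = 0 := by
  have := theta1_neg k 0
  rw [neg_zero] at this
  linear_combination this / 2

variable {k}

lemma differentiable_jacobiTheta₂ {τ : ℂ} (hτ : 0 < τ.im) :
    Differentiable ℂ fun z => jacobiTheta₂ z τ :=
  fun z => differentiableAt_jacobiTheta₂_fst z hτ

lemma differentiable_theta3 (hτ : 0 < (tau k).im) : Differentiable ℂ (theta3 k) :=
  differentiable_jacobiTheta₂ hτ

lemma differentiable_theta4 (hτ : 0 < (tau k).im) : Differentiable ℂ (theta4 k) :=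
  (differentiable_jacobiTheta₂ hτ).comp (differentiable_id.add_const _)

lemma differentiable_theta2 (hτ : 0 < (tau k).im) : Differentiable ℂ (theta2 k) :=
  Differentiable.mul (by fun_prop)
    ((differentiable_jacobiTheta₂ hτ).comp (differentiable_id.add_const _))

lemma differentiable_theta1 (hτ : 0 < (tau k).im) : Differentiable ℂ (theta1 k) :=
  Differentiable.mul (by fun_prop)
    ((differentiable_jacobiTheta₂ hτ).comp (differentiable_id.add_const _))

/-! ### The nome, non-vanishing of theta values, and the derivative `θ₁'(0)` -/

/-- The nome `q = exp (iπτ)`. -/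
def nome (k : ℝ) : ℂ := Complex.exp (Real.pi * Complex.I * tau k)

lemma norm_nome_lt (hτ : 0 < (tau k).im) : ‖nome k‖ < 1 := by
  rw [nome, Complex.norm_exp, Real.exp_lt_one_iff]
  simpa using mul_pos Real.pi_pos hτ

lemma norm_nome_sq_lt (hτ : 0 < (tau k).im) : ‖nome k ^ 2‖ < 1 := by
  rw [norm_pow]
  exact pow_lt_one₀ (norm_nonneg _) (norm_nome_lt hτ) two_ne_zero

lemma theta2_eq_qProd (hτ : 0 < (tau k).im) (z : ℂ) :
    theta2 k z = Complex.exp (Real.pi * Complex.I * (tau k / 4 + z)) *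
      (qProd (nome k ^ 2) (-nome k ^ 2) *
        qProd (nome k ^ 2) (nome k ^ 2 * Complex.exp (2 * Real.pi * Complex.I * z)) *
        ((1 + (Complex.exp (2 * Real.pi * Complex.I * z))⁻¹) *
        qProd (nome k ^ 2) (nome k ^ 2 * (Complex.exp (2 * Real.pi * Complex.I * z))⁻¹))) := by
  have hw : Complex.exp (2 * Real.pi * Complex.I * (z + tau k / 2)) =
      nome k * Complex.exp (2 * Real.pi * Complex.I * z) := by
    rw [nome, ← Complex.exp_add]; ring_nf
  have hq : nome k ≠ 0 := Complex.exp_ne_zero _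
  rw [theta2, jacobiTheta₂_eq_qProd _ hτ, ← nome, hw, mul_inv, mul_inv_cancel_left₀ hq,
    qProd_eq (norm_nome_sq_lt hτ) (Complex.exp (2 * Real.pi * Complex.I * z))⁻¹]
  ring_nf

/-- `θ₂` has no zeros on the open real interval `(-1/2, 1/2)`. -/
lemma theta2_ofReal_ne_zero (hτ : 0 < (tau k).im) {x : ℝ} (hx : |x| < 1 / 2) :
    theta2 k x ≠ 0 := by
  have hQ := norm_nome_sq_lt hτ
  have hn : ‖Complex.exp (2 * Real.pi * Complex.I * x)‖ = 1 := by
    rw [show 2 * Real.pi * Complex.I * (x : ℂ) = ((2 * Real.pi * x : ℝ) : ℂ) * Complex.I by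
      push_cast; ring, Complex.norm_exp_ofReal_mul_I]
  rw [theta2_eq_qProd hτ]
  refine mul_ne_zero (Complex.exp_ne_zero _) (mul_ne_zero (mul_ne_zero ?_ ?_) (mul_ne_zero ?_ ?_))
  · exact qProd_ne_zero_of_norm_lt hQ (by simpa using hQ)
  · exact qProd_ne_zero_of_norm_lt hQ (by simpa [hn] using hQ)
  · rw [← Complex.exp_neg]
    intro h
    have h1 : Complex.exp (Real.pi * Complex.I * x) ≠ 0 := Complex.exp_ne_zero _
    -- The one factor not controlled by norms is `1 + e^{-2πix} = 2 e^{-πix} cos(πx)`, and the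
    -- cosine is positive for `|x| < 1/2`.
    have h2 : 2 * Complex.cos (Real.pi * x) = 0 := by
      have h3 : Complex.exp (Real.pi * Complex.I * x) *
          (1 + Complex.exp (-(2 * Real.pi * Complex.I * x))) = 0 := by rw [h, mul_zero]
      rw [mul_add, ← Complex.exp_add, mul_one] at h3
      rw [Complex.two_cos, ← h3]
      ring_nf
    have h4 : Real.cos (Real.pi * x) = 0 := by
      have : ((Real.cos (Real.pi * x) : ℝ) : ℂ) = 0 := by
        push_cast; linear_combination h2 / 2
      exact_mod_cast this
    have hx' := abs_lt.1 hx
    exact (Real.cos_pos_of_mem_Ioo ⟨by nlinarith [Real.pi_pos], by nlinarith [Real.pi_pos]⟩).ne' h4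
  · exact qProd_ne_zero_of_norm_lt hQ (by simpa [hn] using hQ)

/-- Isolates the factor carrying the simple zero at `0`, so that the derivative there requires only
continuity of the cofactor. -/
lemma theta1_eq_qProd (hτ : 0 < (tau k).im) (z : ℂ) :
    theta1 k z = (1 - Complex.exp (-(2 * Real.pi * Complex.I * z))) *
      (-Complex.I * Complex.exp (Real.pi * Complex.I * (tau k / 4 + z)) *
      (qProd (nome k ^ 2) (-nome k ^ 2) *
        qProd (nome k ^ 2) (-nome k ^ 2 * Complex.exp (2 * Real.pi * Complex.I * z)) *
        qProd (nome k ^ 2) (-nome k ^ 2 * Complex.exp (-(2 * Real.pi * Complex.I * z))))) := by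
  have h1 : Complex.exp (2 * Real.pi * Complex.I * (z - 1 / 2)) =
      -Complex.exp (2 * Real.pi * Complex.I * z) := by
    rw [show 2 * Real.pi * Complex.I * (z - 1 / 2) =
      2 * Real.pi * Complex.I * z - Real.pi * Complex.I by ring, Complex.exp_sub,
      Complex.exp_pi_mul_I]
    ring
  have h2 : Complex.exp (Real.pi * Complex.I * (tau k / 4 + (z - 1 / 2))) =
      -Complex.I * Complex.exp (Real.pi * Complex.I * (tau k / 4 + z)) := by
    rw [show Real.pi * Complex.I * (tau k / 4 + (z - 1 / 2)) =
      Real.pi * Complex.I * (tau k / 4 + z) + -(Real.pi / 2 * Complex.I) by ring, Complex.exp_add,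
      Complex.exp_neg, Complex.exp_pi_div_two_mul_I, Complex.inv_I]
    ring
  rw [theta1_eq_theta2, theta2_eq_qProd hτ, h1, h2, inv_neg, ← Complex.exp_neg]
  ring_nf

/-- Jacobi's derivative formula `θ₁'(0) = π θ₂(0) θ₃(0) θ₄(0)`. -/
theorem hasDerivAt_theta1_zero (hτ : 0 < (tau k).im) :
    HasDerivAt (theta1 k) (Real.pi * theta2 k 0 * theta3 k 0 * theta4 k 0) 0 := by
  have hQ := norm_nome_sq_lt hτ
  set Q := nome k ^ 2 with hQdef
  set κ := Complex.exp (Real.pi * Complex.I * (tau k / 4)) with hκ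
  have h3 : theta3 k 0 = qProd Q (-Q) * qProd Q (nome k) * qProd Q (nome k) := by
    rw [theta3, jacobiTheta₂_eq_qProd 0 hτ, ← nome]; simp [hQdef]
  have h4 : theta4 k 0 = qProd Q (-Q) * qProd Q (-nome k) * qProd Q (-nome k) := by
    have : Complex.exp (2 * Real.pi * Complex.I * (0 + 1 / 2)) = -1 := by
      rw [← Complex.exp_pi_mul_I]; ring_nf
    rw [theta4, jacobiTheta₂_eq_qProd _ hτ, ← nome, this, inv_neg, inv_one, mul_neg_one]
  have h2 : theta2 k 0 = 2 * κ * qProd Q (-Q) * qProd Q Q * qProd Q Q := by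
    rw [theta2_eq_qProd hτ]
    simp only [mul_zero, Complex.exp_zero, inv_one, mul_one, add_zero, ← hQdef, ← hκ]
    ring
  -- The square of Euler's identity removes every product except `(Q; Q)_∞³`.
  have hval : Real.pi * theta2 k 0 * theta3 k 0 * theta4 k 0 =
      (2 * Real.pi * Complex.I) * (-Complex.I * κ * (qProd Q (-Q) * qProd Q (-Q) * qProd Q (-Q))) := by
    have hE := qProd_mul_qProd_mul_qProd (norm_nome_lt hτ)
    rw [← hQdef] at hE
    rw [h2, h3, h4]
    calc _ = 2 * Real.pi * κ * qProd Q (-Q) ^ 3 *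
          (qProd Q Q * qProd Q (nome k) * qProd Q (-nome k)) ^ 2 := by ring
      _ = _ := by rw [hE]; linear_combination (2 * Real.pi * κ * qProd Q (-Q) ^ 3) * Complex.I_sq
  rw [hval, hasDerivAt_iff_tendsto_slope]
  have hd : HasDerivAt (fun z : ℂ => 1 - Complex.exp (-(2 * Real.pi * Complex.I * z)))
      (2 * Real.pi * Complex.I) 0 := by
    have := ((((hasDerivAt_id (0 : ℂ)).const_mul (2 * Real.pi * Complex.I)).neg).cexp).const_sub 1
    simpa using this
  have hc : Filter.Tendsto (fun z : ℂ =>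
      (-Complex.I * Complex.exp (Real.pi * Complex.I * (tau k / 4 + z)) *
      (qProd Q (-Q) * qProd Q (-Q * Complex.exp (2 * Real.pi * Complex.I * z)) *
        qProd Q (-Q * Complex.exp (-(2 * Real.pi * Complex.I * z)))))) (𝓝[≠] 0)
      (𝓝 (-Complex.I * κ * (qProd Q (-Q) * qProd Q (-Q) * qProd Q (-Q)))) := by
    have hcont : Continuous (fun z : ℂ =>
      (-Complex.I * Complex.exp (Real.pi * Complex.I * (tau k / 4 + z)) *
      (qProd Q (-Q) * qProd Q (-Q * Complex.exp (2 * Real.pi * Complex.I * z)) *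
        qProd Q (-Q * Complex.exp (-(2 * Real.pi * Complex.I * z)))))) := by
      have := continuous_qProd hQ
      fun_prop
    have := (hcont.tendsto 0).mono_left (nhdsWithin_le_nhds (s := {0}ᶜ))
    simpa [hκ] using this
  refine ((hasDerivAt_iff_tendsto_slope.1 hd).mul hc).congr fun z => ?_
  rw [slope_def_field, slope_def_field, theta1_zero, theta1_eq_qProd hτ z, ← hQdef]
  simp
  ring

lemma theta2_zero_ne_zero (hτ : 0 < (tau k).im) : theta2 k 0 ≠ 0 := by
  simpa using theta2_ofReal_ne_zero hτ (x := 0) (by norm_num)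

lemma deriv_theta1_ne_zero (hτ : 0 < (tau k).im) :
    Real.pi * theta2 k 0 * theta3 k 0 * theta4 k 0 ≠ 0 := by
  have hQ := norm_nome_sq_lt hτ
  have hq := norm_nome_lt hτ
  refine mul_ne_zero (mul_ne_zero (mul_ne_zero (by exact_mod_cast Real.pi_ne_zero)
    (theta2_zero_ne_zero hτ)) ?_) ?_
  · rw [theta3, jacobiTheta₂_eq_qProd 0 hτ, ← nome]
    refine mul_ne_zero (mul_ne_zero ?_ ?_) ?_ <;>
    exact qProd_ne_zero_of_norm_lt hQ (by simpa using by first | exact hQ | exact hq)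
  · have : Complex.exp (2 * Real.pi * Complex.I * (0 + 1 / 2)) = -1 := by
      rw [← Complex.exp_pi_mul_I]; ring_nf
    rw [theta4, jacobiTheta₂_eq_qProd _ hτ, ← nome, this]
    refine mul_ne_zero (mul_ne_zero ?_ ?_) ?_ <;>
    exact qProd_ne_zero_of_norm_lt hQ (by simpa [inv_neg] using by first | exact hQ | exact hq)

/-! ### Expansions in half-integral powers -/

/-- A power series whose sum vanishes at all small positive reals is zero. -/
lemma eq_zero_of_hasSum_pow_zero {E : Type*} [NormedAddCommGroup E] [NormedSpace ℂ E]
    [CompleteSpace E] {c : ℕ → E}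
    (h : ∀ᶠ ξ : ℝ in 𝓝[>] 0, HasSum (fun s : ℕ => (ξ : ℂ) ^ s • c s) 0) : c = 0 := by
  let p : FormalMultilinearSeries ℂ ℂ E := fun n => ContinuousMultilinearMap.mkPiRing ℂ (Fin n) (c n)
  have hp : ∀ (n : ℕ) (z : ℂ), p n (fun _ => z) = z ^ n • c n := fun n z => by simp [p]
  -- Convergence at a single `r > 0` already gives a positive radius; the identity theorem applies
  -- because positive reals accumulate at `0`.
  obtain ⟨r, hr, hr0⟩ := (h.and self_mem_nhdsWithin).exists
  have hr0 : 0 < r := hr0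
  have hrad : 0 < p.radius := by
    refine lt_of_lt_of_le ?_ (p.le_radius_of_tendsto (r := ⟨r, hr0.le⟩) (l := 0) ?_)
    · exact ENNReal.coe_pos.2 hr0
    · have := hr.summable.tendsto_atTop_zero.norm
      simp only [norm_zero, norm_smul, norm_pow, Complex.norm_real, Real.norm_eq_abs,
        abs_of_pos hr0] at this
      refine this.congr fun n => ?_
      simp only [p, ContinuousMultilinearMap.norm_mkPiRing]
      exact mul_comm _ _
  have hsum := p.hasFPowerSeriesOnBall hrad
  have hz : ∀ᶠ z in 𝓝 (0 : ℂ), p.sum z = 0 := by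
    refine hsum.analyticAt.frequently_zero_iff_eventually_zero.1 ?_
    have ht : Filter.Tendsto (fun ξ : ℝ => (ξ : ℂ)) (𝓝[>] 0) (𝓝[≠] 0) := by
      refine tendsto_nhdsWithin_iff.2 ⟨?_, ?_⟩
      · exact (Complex.continuous_ofReal.tendsto' 0 0 (by simp)).mono_left nhdsWithin_le_nhds
      · filter_upwards [self_mem_nhdsWithin] with ξ hξ
        simpa using (ne_of_gt hξ)
    refine ht.frequently (h.mono fun ξ hξ => ?_).frequently
    simp only [FormalMultilinearSeries.sum, hp]
    exact hξ.tsum_eq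
  have := hsum.hasFPowerSeriesAt.eq_zero_of_eventually hz
  funext n
  have h1 := hp n 1
  rw [this] at h1
  simpa using h1.symm

lemma rpow_nat_sub_eq {ξ : ℝ} (hξ : 0 < ξ) (s : ℕ) :
    ((ξ ^ ((s : ℝ) - 5 / 2) : ℝ) : ℂ) = ((ξ ^ (-(5 / 2) : ℝ) : ℝ) : ℂ) * (ξ : ℂ) ^ s := by
  rw [show (s : ℝ) - 5 / 2 = -(5 / 2) + s by ring, Real.rpow_add hξ, Real.rpow_natCast]
  push_cast
  rfl

lemma hasPoleExpansion_iff {f : ℝ → Fin 2 × Fin 2 → ℂ} {c : ℕ → Fin 2 × Fin 2 → ℂ}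
    {Φ : ℝ → Fin 2 × Fin 2 → ℂ}
    (hf : ∀ᶠ ξ : ℝ in 𝓝[>] 0, f ξ = ((ξ ^ (-(5 / 2) : ℝ) : ℝ) : ℂ) • Φ ξ) :
    HasPoleExpansion f c ↔ ∀ᶠ ξ : ℝ in 𝓝[>] 0, HasSum (fun s : ℕ => (ξ : ℂ) ^ s • c s) (Φ ξ) := by
  refine Filter.eventually_congr ?_
  filter_upwards [hf, self_mem_nhdsWithin] with ξ h hξ
  have hξ : 0 < ξ := hξ
  have hne : ((ξ ^ (-(5 / 2) : ℝ) : ℝ) : ℂ) ≠ 0 := by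
    exact_mod_cast (Real.rpow_pos_of_pos hξ _).ne'
  simp only [rpow_nat_sub_eq hξ, mul_smul, h]
  refine ⟨fun hs => ?_, fun hs => hs.const_smul _⟩
  have := hs.const_smul ((ξ ^ (-(5 / 2) : ℝ) : ℝ) : ℂ)⁻¹
  simpa only [inv_smul_smul₀ hne] using this

/-- If `f(ξ) = ξ^(-5/2) Φ(ξ)` with `Φ` analytic at `0`, then `f` has a unique expansion, and
`-e ξ^(-5/2) M Φ(-ξ)` has the expansion with the coefficients of `f`, multiplied by `M` and with
alternating signs. -/
lemma poleExpansion_of_analyticAt {f g : ℝ → Fin 2 × Fin 2 → ℂ} {Φ : ℂ → Fin 2 × Fin 2 → ℂ}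
    (hΦ : AnalyticAt ℂ Φ 0) (e : ℂ) (M : Matrix (Fin 2 × Fin 2) (Fin 2 × Fin 2) ℂ)
    (hf : ∀ᶠ ξ : ℝ in 𝓝[>] 0, f ξ = ((ξ ^ (-(5 / 2) : ℝ) : ℝ) : ℂ) • Φ ξ)
    (hg : ∀ᶠ ξ : ℝ in 𝓝[>] 0,
      g ξ = ((ξ ^ (-(5 / 2) : ℝ) : ℝ) : ℂ) • (-e) • M.mulVec (Φ (-ξ))) :
    (∃! c, HasPoleExpansion f c) ∧ ∀ c, HasPoleExpansion f c →
      HasPoleExpansion g fun s => -((-1 : ℂ) ^ s * e) • M.mulVec (c s) := by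
  obtain ⟨p, hp⟩ := hΦ
  have hp := hasFPowerSeriesAt_iff.1 hp
  simp only [zero_add] at hp
  have ht : Filter.Tendsto (fun ξ : ℝ => (ξ : ℂ)) (𝓝[>] 0) (𝓝 0) :=
    (Complex.continuous_ofReal.tendsto' 0 0 (by simp)).mono_left nhdsWithin_le_nhds
  have ht' : Filter.Tendsto (fun ξ : ℝ => -(ξ : ℂ)) (𝓝[>] 0) (𝓝 0) := by simpa using ht.neg
  have hex : HasPoleExpansion f p.coeff :=
    (hasPoleExpansion_iff (Φ := fun ξ => Φ ξ) hf).2 (ht.eventually hp)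
  have huniq : ∀ c, HasPoleExpansion f c → c = p.coeff := by
    intro c hc
    rw [hasPoleExpansion_iff (Φ := fun ξ => Φ ξ) hf] at hc
    refine sub_eq_zero.1 (eq_zero_of_hasSum_pow_zero ?_)
    filter_upwards [hc, ht.eventually hp] with ξ h1 h2
    simpa [smul_sub] using h1.sub h2
  refine ⟨⟨p.coeff, hex, huniq⟩, fun c hc => ?_⟩
  rw [huniq c hc]
  refine (hasPoleExpansion_iff (Φ := fun ξ => (-e) • M.mulVec (Φ (-ξ))) hg).2 ?_
  filter_upwards [ht'.eventually hp] with ξ hξ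
  have h1 := (hξ.mapL (Matrix.mulVecLin M).toContinuousLinearMap).const_smul (-e)
  refine (congrArg₂ (fun (f : ℕ → Fin 2 × Fin 2 → ℂ) s => HasSum f s) (funext fun s => ?_) ?_).mpr h1
  · simp only [map_smul, LinearMap.coe_toContinuousLinearMap', Matrix.mulVecLin_apply, smul_smul]
    congr 1
    rw [neg_pow]
    ring
  · rfl

/-! ### The singularity of the Nahm data -/

lemma f3_neg (z : ℝ) : f3 k (-z) = f3 k z := by
  simp only [f3, Complex.ofReal_neg, neg_div, theta4_neg, theta2_neg]

lemma halfInt_neg (z : ℝ) : halfInt k (-z) = -halfInt k z := by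
  have h := intervalIntegral.integral_comp_neg (f3 k) (a := 0) (b := z)
  simp only [f3_neg, neg_zero] at h
  rw [halfInt, halfInt, intervalIntegral.integral_symm, ← h]
  ring

lemma continuousOn_f3 (hτ : 0 < (tau k).im) : ContinuousOn (f3 k) (Set.Ioo (-1) 1) := by
  have h4 := (differentiable_theta4 hτ).continuous
  have h2 := (differentiable_theta2 hτ).continuous
  refine ContinuousOn.mul continuousOn_const (ContinuousOn.div ?_ ?_ fun x hx => ?_)
  · exact (h4.comp (Complex.continuous_ofReal.div_const _)).continuousOn
  · exact (h2.comp (Complex.continuous_ofReal.div_const _)).continuousOn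
  · have := theta2_ofReal_ne_zero hτ (x := x / 2) (by
      rw [abs_lt]; constructor <;> linarith [hx.1, hx.2])
    simpa using this

lemma hasDerivAt_halfInt (hτ : 0 < (tau k).im) {z : ℝ} (hz : z ∈ Set.Ioo (-1 : ℝ) 1) :
    HasDerivAt (halfInt k) (f3 k z / 2) z := by
  have hc := continuousOn_f3 hτ
  refine (intervalIntegral.integral_hasDerivAt_right ?_ ?_ ?_).div_const 2
  · refine (hc.mono ?_).intervalIntegrable
    exact (convex_Ioo _ _).ordConnected.uIcc_subset (by norm_num) hz
  · exact hc.stronglyMeasurableAtFilter isOpen_Ioo z hz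
  · exact hc.continuousAt (isOpen_Ioo.mem_nhds hz)

/-- The function `θ₁(ξ/2) / ξ`, extended to `ξ = 0`. -/
def thetaSlope (k : ℝ) : ℂ → ℂ := dslope (fun ξ => theta1 k (ξ / 2)) 0

lemma mul_thetaSlope (ξ : ℂ) : ξ * thetaSlope k ξ = theta1 k (ξ / 2) := by
  have := sub_smul_dslope (fun ξ => theta1 k (ξ / 2)) 0 ξ
  simpa [theta1_zero, thetaSlope] using this

lemma thetaSlope_neg (ξ : ℂ) : thetaSlope k (-ξ) = thetaSlope k ξ := by
  rcases eq_or_ne ξ 0 with rfl | h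
  · simp
  · apply mul_left_cancel₀ h
    have h1 := mul_thetaSlope (k := k) (-ξ)
    rw [neg_div, theta1_neg] at h1
    rw [mul_thetaSlope]
    linear_combination -h1

lemma differentiable_thetaSlope (hτ : 0 < (tau k).im) : Differentiable ℂ (thetaSlope k) := by
  rw [← differentiableOn_univ]
  refine (Complex.differentiableOn_dslope Filter.univ_mem).2 (Differentiable.differentiableOn ?_)
  exact (differentiable_theta1 hτ).comp (differentiable_id.div_const _)

lemma thetaSlope_zero (hτ : 0 < (tau k).im) :
    thetaSlope k 0 = Real.pi * theta2 k 0 * theta3 k 0 * theta4 k 0 / 2 := by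
  rw [thetaSlope, dslope_same]
  have h1 : HasDerivAt (theta1 k) (Real.pi * theta2 k 0 * theta3 k 0 * theta4 k 0) ((0 : ℂ) / 2) := by
    simpa using hasDerivAt_theta1_zero hτ
  have h := h1.comp (0 : ℂ) ((hasDerivAt_id (0 : ℂ)).div_const 2)
  have := h.deriv
  simp only [Function.comp_def, id] at this
  rw [this]
  ring

lemma thetaSlope_zero_ne_zero (hτ : 0 < (tau k).im) : thetaSlope k 0 ≠ 0 := by
  rw [thetaSlope_zero hτ]
  exact div_ne_zero (deriv_theta1_ne_zero hτ) two_ne_zero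

/-- The function `ξ f₃(1 - ξ)`, extended to `ξ = 0`. -/
def mulF3 (k : ℝ) (ξ : ℂ) : ℂ :=
  Real.pi * theta2 k 0 * theta4 k 0 / 2 * (theta3 k (ξ / 2) / thetaSlope k ξ)

lemma mulF3_neg (ξ : ℂ) : mulF3 k (-ξ) = mulF3 k ξ := by
  rw [mulF3, mulF3, thetaSlope_neg, neg_div, theta3_neg]

/-- Jacobi's formula cancels the constants in `f₃`. The value `1` is what fixes the exponent `-1/2`
of `e^h` at the endpoint. -/
lemma mulF3_zero (hτ : 0 < (tau k).im) : mulF3 k 0 = 1 := by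
  have h := deriv_theta1_ne_zero hτ
  rw [mulF3, thetaSlope_zero hτ, zero_div, ← mul_div_assoc, div_eq_one_iff_eq (by simpa using h)]
  ring

lemma f3_one_sub {ξ : ℝ} (hξ : ξ ≠ 0) : f3 k (1 - ξ) = mulF3 k ξ / ξ := by
  have h : ((1 - ξ : ℝ) : ℂ) / 2 = 1 / 2 - (ξ : ℂ) / 2 := by push_cast; ring
  have h0 : (ξ : ℂ) ≠ 0 := by exact_mod_cast hξ
  rw [f3, h, theta4_half_sub, theta2_half_sub, ← mul_thetaSlope, mulF3]
  rw [mul_div_assoc (_ / 2), div_div, mul_comm (ξ : ℂ)]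

lemma theta2_one_sub_div_two (ξ : ℂ) : theta2 k ((1 - ξ) / 2) = ξ * thetaSlope k ξ := by
  rw [mul_thetaSlope, ← theta2_half_sub]
  ring_nf

/-- Near the endpoint, `exp (halfInt (1 - ξ)) = ξ^(-1/2) g(ξ)` with `g` analytic, even and without
zeros. -/
lemma exists_exp_halfInt (hτ : 0 < (tau k).im) :
    ∃ g : ℂ → ℂ, AnalyticAt ℂ g 0 ∧ (∀ ξ, g ξ ≠ 0) ∧ (∀ᶠ ξ in 𝓝 0, g (-ξ) = g ξ) ∧
      ∀ᶠ ξ : ℝ in 𝓝[>] 0,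
        Complex.exp (halfInt k (1 - ξ)) = ((ξ ^ (-(1 / 2) : ℝ) : ℝ) : ℂ) * g ξ := by
  have hS := differentiable_thetaSlope hτ
  obtain ⟨r, hr0, hr⟩ := Metric.eventually_nhds_iff_ball.1
    (hS.continuous.continuousAt.eventually_ne (thetaSlope_zero_ne_zero hτ))
  have hd : DifferentiableOn ℂ (mulF3 k) (Metric.ball 0 r) := by
    have h3 : Differentiable ℂ fun ξ : ℂ => theta3 k (ξ / 2) :=
      (differentiable_theta3 hτ).comp (differentiable_id.div_const _)
    exact (h3.differentiableOn.div hS.differentiableOn hr).const_mul _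
  have hball : Metric.ball (0 : ℂ) r ∈ 𝓝 0 := Metric.ball_mem_nhds 0 hr0
  have hψ : DifferentiableOn ℂ (dslope (mulF3 k) 0) (Metric.ball 0 r) :=
    (Complex.differentiableOn_dslope hball).2 hd
  have hψeq : ∀ ξ : ℂ, mulF3 k ξ = 1 + ξ * dslope (mulF3 k) 0 ξ := by
    intro ξ
    have := sub_smul_dslope (mulF3 k) 0 ξ
    rw [mulF3_zero hτ, sub_zero, smul_eq_mul] at this
    rw [this]; ring
  have hψneg : ∀ ξ : ℂ, ξ ≠ 0 → dslope (mulF3 k) 0 (-ξ) = -dslope (mulF3 k) 0 ξ := by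
    intro ξ hξ
    have h1 := hψeq (-ξ)
    rw [mulF3_neg, hψeq] at h1
    apply mul_left_cancel₀ hξ
    linear_combination h1
  obtain ⟨Ψ, hΨ⟩ := hψ.isExactOn_ball
  have hneg : ∀ ξ ∈ Metric.ball (0 : ℂ) r, -ξ ∈ Metric.ball (0 : ℂ) r := by simp
  -- At `0` the slope is the derivative of an even function, hence zero.
  have hψ0 : dslope (mulF3 k) 0 0 = 0 := by
    rw [dslope_same]
    have h1 : deriv (fun ξ => mulF3 k (-ξ)) 0 = -deriv (mulF3 k) 0 := by
      rw [deriv_comp_neg, neg_zero]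
    simp only [mulF3_neg] at h1
    linear_combination h1 / 2
  have hψneg' : ∀ ξ : ℂ, dslope (mulF3 k) 0 (-ξ) = -dslope (mulF3 k) 0 ξ := by
    intro ξ
    rcases eq_or_ne ξ 0 with rfl | h
    · rw [neg_zero, hψ0, neg_zero]
    · exact hψneg ξ h
  have hΨeven : ∀ ξ ∈ Metric.ball (0 : ℂ) r, Ψ (-ξ) = Ψ ξ := by
    have hD : ∀ ξ ∈ Metric.ball (0 : ℂ) r, HasDerivAt (fun ξ => Ψ (-ξ) - Ψ ξ) 0 ξ := by
      intro ξ hξ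
      have h1 := ((hΨ (-ξ) (hneg ξ hξ)).scomp ξ (hasDerivAt_neg ξ)).sub (hΨ ξ hξ)
      rw [hψneg'] at h1
      exact h1.congr_deriv (by simp)
    intro ξ hξ
    have := Metric.isOpen_ball.is_const_of_deriv_eq_zero (convex_ball (0 : ℂ) r).isPreconnected
      (fun z hz => (hD z hz).differentiableAt.differentiableWithinAt)
      (fun z hz => (hD z hz).deriv) hξ (Metric.mem_ball_self hr0)
    simpa [sub_eq_zero] using this
  -- The derivative of `h(1 - ξ)` is `-1/(2ξ) - ψ(ξ)/2`, which the logarithm and `Ψ/2` cancel. The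
  -- bound `1` keeps `1 - ξ` inside `(-1, 1)`, the bound `r` keeps `ξ` in the disc of `Ψ`.
  have hconst : ∃ C : ℂ, ∀ ξ ∈ Set.Ioo (0 : ℝ) (min r 1),
      halfInt k (1 - ξ) + (Real.log ξ : ℂ) / 2 + Ψ ξ / 2 = C := by
    have hD : ∀ ξ ∈ Set.Ioo (0 : ℝ) (min r 1), HasDerivAt
        (fun ξ : ℝ => halfInt k (1 - ξ) + (Real.log ξ : ℂ) / 2 + Ψ ξ / 2) 0 ξ := by
      intro ξ hξ
      have hξr : ξ < r := hξ.2.trans_le (min_le_left _ _)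
      have hξ1 : ξ < 1 := hξ.2.trans_le (min_le_right _ _)
      have hmem : (ξ : ℂ) ∈ Metric.ball (0 : ℂ) r := by
        simpa [abs_of_pos hξ.1] using hξr
      have hz : 1 - ξ ∈ Set.Ioo (-1 : ℝ) 1 := ⟨by linarith, by linarith [hξ.1]⟩
      have h1 := (hasDerivAt_halfInt hτ hz).scomp ξ ((hasDerivAt_id ξ).const_sub 1)
      have h2 := ((Real.hasDerivAt_log hξ.1.ne').ofReal_comp).div_const 2
      have h3 := ((hΨ ξ hmem).comp_ofReal).div_const 2
      have h0 : (ξ : ℂ) ≠ 0 := by exact_mod_cast hξ.1.ne'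
      refine ((h1.add h2).add h3).congr_deriv ?_
      rw [f3_one_sub hξ.1.ne', hψeq]
      simp
      field_simp
      ring
    exact isOpen_Ioo.exists_is_const_of_deriv_eq_zero isPreconnected_Ioo
      (fun z hz => (hD z hz).differentiableAt.differentiableWithinAt)
      (fun z hz => (hD z hz).deriv)
  obtain ⟨C, hC⟩ := hconst
  refine ⟨fun ξ => Complex.exp (C - Ψ ξ / 2), ?_, fun ξ => Complex.exp_ne_zero _, ?_, ?_⟩
  · have hΨd : DifferentiableOn ℂ Ψ (Metric.ball 0 r) :=
      fun z hz => (hΨ z hz).differentiableAt.differentiableWithinAt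
    exact (((hΨd.div_const 2).const_sub C).cexp).analyticAt hball
  · filter_upwards [hball] with ξ hξ
    rw [hΨeven ξ hξ]
  · filter_upwards [Ioo_mem_nhdsGT (lt_min hr0 one_pos)] with ξ hξ
    have h := hC ξ hξ
    rw [Real.rpow_def_of_pos hξ.1, Complex.ofReal_exp, ← Complex.exp_add, ← h]
    congr 1
    push_cast
    ring

/-! ### The solution columns near the endpoints -/

lemma gaugeC_inv (k z : ℝ) : (gaugeC k z)⁻¹ =
    !![Complex.cosh (halfInt k z), -Complex.sinh (halfInt k z);
      -Complex.sinh (halfInt k z), Complex.cosh (halfInt k z)] := by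
  have h := Complex.cosh_sq_sub_sinh_sq (halfInt k z)
  refine Matrix.inv_eq_right_inv ?_
  rw [gaugeC, Matrix.mul_fin_two, Matrix.one_fin_two]
  have h1 : Complex.cosh (halfInt k z) * Complex.cosh (halfInt k z) +
      Complex.sinh (halfInt k z) * -Complex.sinh (halfInt k z) = 1 := by linear_combination h
  have h2 : Complex.sinh (halfInt k z) * -Complex.sinh (halfInt k z) +
      Complex.cosh (halfInt k z) * Complex.cosh (halfInt k z) = 1 := by linear_combination h
  rw [h1, h2]
  ring_nf

lemma orthO_mul_gaugeC_inv (k z : ℝ) : orthO * (gaugeC k z)⁻¹ = (1 / (Real.sqrt 2 : ℂ)) •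
    !![Complex.exp (halfInt k z), -Complex.exp (halfInt k z);
      Complex.exp (-halfInt k z), Complex.exp (-halfInt k z)] := by
  rw [gaugeC_inv, orthO, Matrix.smul_mul, Matrix.mul_fin_two, ← Complex.cosh_add_sinh,
    ← Complex.cosh_sub_sinh]
  ring_nf

lemma vBar_apply (k x₁ x₂ x₃ x₄ : ℝ) (N : ℤ) (ζ a : Fin 4 → ℂ) (i : Fin 4) (z : ℝ)
    (p : Fin 2 × Fin 2) :
    vBar k x₁ x₂ x₃ x₄ N ζ a i z p = 1 / (Real.sqrt 2 : ℂ) * (1 / theta2 k (z / 2) ^ 2) *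
      (![Complex.exp (halfInt k z) * (lambdaBar k x₁ x₂ x₃ x₄ N ζ a i z (p.1, 0) -
          lambdaBar k x₁ x₂ x₃ x₄ N ζ a i z (p.1, 1)),
        Complex.exp (-halfInt k z) * (lambdaBar k x₁ x₂ x₃ x₄ N ζ a i z (p.1, 0) +
          lambdaBar k x₁ x₂ x₃ x₄ N ζ a i z (p.1, 1))] : Fin 2 → ℂ) p.2 := by
  obtain ⟨p, s⟩ := p
  rw [vBar, orthO_mul_gaugeC_inv]
  fin_cases p <;> fin_cases s <;>
  · simp [Matrix.mulVec, dotProduct, Fintype.sum_prod_type, Matrix.one_apply]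
    ring

/-- Parity count: the shift negates `θ₂` and fixes `θ₄`. The first entries contain two or no
`z`-dependent factors `θ₂`, the second entries exactly one. -/
lemma lambdaBar_eq_add_two (k x₁ x₂ x₃ x₄ : ℝ) (N : ℤ) (ζ a : Fin 4 → ℂ) (i : Fin 4) (z : ℂ)
    (p : Fin 2) :
    lambdaBar k x₁ x₂ x₃ x₄ N ζ a i z (p, 0) =
      Complex.exp (2 * mu k x₁ x₂ x₃ x₄ N (ζ i) (a i)) *
        lambdaBar k x₁ x₂ x₃ x₄ N ζ a i (z + 2) (p, 0) ∧
    lambdaBar k x₁ x₂ x₃ x₄ N ζ a i z (p, 1) =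
      -(Complex.exp (2 * mu k x₁ x₂ x₃ x₄ N (ζ i) (a i)) *
        lambdaBar k x₁ x₂ x₃ x₄ N ζ a i (z + 2) (p, 1)) := by
  have h2 : ∀ b : ℂ, theta2 k (b - (z + 2) / 2) = -theta2 k (b - z / 2) := fun b => by
    rw [eq_neg_iff_add_eq_zero, show b - z / 2 = b - (z + 2) / 2 + 1 by ring, theta2_add_one]
    ring
  have h2' : theta2 k ((z + 2) / 2) = -theta2 k (z / 2) := by
    rw [← theta2_add_one]; ring_nf
  have h4 : ∀ b : ℂ, theta4 k (b - (z + 2) / 2) = theta4 k (b - z / 2) := fun b => by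
    rw [← theta4_add_one]; ring_nf
  have he : ∀ m : ℂ, Complex.exp (-z * m) = Complex.exp (2 * m) * Complex.exp (-(z + 2) * m) :=
    fun m => by rw [← Complex.exp_add]; ring_nf
  constructor
  · simp only [lambdaBar, colA, colAlpha, Matrix.cons_val_zero, h2, h2', h4, he]
    ring
  · simp only [lambdaBar, colB, colBeta, Matrix.cons_val_one, Matrix.cons_val_fin_one, h2, h2', h4,
      he]
    ring

lemma differentiable_lambdaBar {k : ℝ} (hτ : 0 < (tau k).im) (x₁ x₂ x₃ x₄ : ℝ) (N : ℤ)
    (ζ a : Fin 4 → ℂ) (i : Fin 4) (p : Fin 2 × Fin 2) :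
    Differentiable ℂ fun z => lambdaBar k x₁ x₂ x₃ x₄ N ζ a i z p := by
  have h2 := differentiable_theta2 hτ
  have h4 := differentiable_theta4 hτ
  obtain ⟨p, s⟩ := p
  fin_cases s
  · simp only [lambdaBar, colA, colAlpha, Fin.zero_eta, Matrix.cons_val_zero, div_eq_mul_inv]
    fun_prop
  · simp only [lambdaBar, colB, colBeta, Fin.mk_one, Matrix.cons_val_one, Matrix.cons_val_fin_one,
      div_eq_mul_inv]
    fun_prop

/-- The analytic function `Φ` such that the solution column near `z = 1` is `ξ^(-5/2) Φ(ξ)`; here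
`L` is the column `Λ̄ᵢ`, and `exp (halfInt (1 - ξ)) = ξ^(-1/2) g(ξ)`. -/
def columnGerm (k : ℝ) (g : ℂ → ℂ) (L : ℂ → Fin 2 × Fin 2 → ℂ) (ξ : ℂ) : Fin 2 × Fin 2 → ℂ :=
  fun p => 1 / (Real.sqrt 2 : ℂ) * (1 / thetaSlope k ξ ^ 2) *
    (![g ξ * (L (1 - ξ) (p.1, 0) - L (1 - ξ) (p.1, 1)),
      ξ * (g ξ)⁻¹ * (L (1 - ξ) (p.1, 0) + L (1 - ξ) (p.1, 1))] : Fin 2 → ℂ) p.2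

lemma analyticAt_columnGerm {k : ℝ} (hτ : 0 < (tau k).im) {g : ℂ → ℂ} (hg : AnalyticAt ℂ g 0)
    (hg0 : g 0 ≠ 0) {L : ℂ → Fin 2 × Fin 2 → ℂ} (hL : ∀ p, Differentiable ℂ fun z => L z p) :
    AnalyticAt ℂ (columnGerm k g L) 0 := by
  have hL' : ∀ p, AnalyticAt ℂ (fun ξ => L (1 - ξ) p) 0 := fun p =>
    ((hL p).comp (differentiable_id.const_sub 1)).analyticAt 0
  have ht := (differentiable_thetaSlope hτ).analyticAt 0
  have ht' : AnalyticAt ℂ (fun ξ => 1 / (Real.sqrt 2 : ℂ) * (1 / thetaSlope k ξ ^ 2)) 0 :=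
    analyticAt_const.mul (analyticAt_const.div (ht.pow 2)
      (pow_ne_zero _ (thetaSlope_zero_ne_zero hτ)))
  refine AnalyticAt.pi fun p => ?_
  obtain ⟨p, s⟩ := p
  refine ht'.mul ?_
  fin_cases s
  · exact hg.mul ((hL' _).sub (hL' _))
  · exact (analyticAt_id.mul (hg.inv hg0)).mul ((hL' _).add (hL' _))

lemma rpow_neg_five_halves_mul_sq {ξ : ℝ} (hξ : 0 < ξ) :
    ((ξ ^ (-(5 / 2) : ℝ) : ℝ) : ℂ) * (ξ : ℂ) ^ 2 = ((ξ ^ (-(1 / 2) : ℝ) : ℝ) : ℂ) := by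
  have : ξ ^ (-(5 / 2) : ℝ) * ξ ^ 2 = ξ ^ (-(1 / 2) : ℝ) := by
    rw [← Real.rpow_natCast, ← Real.rpow_add hξ]; norm_num
  exact_mod_cast this

/-- Lets both components share the prefactor `ξ^(-5/2)`. The second one retains an extra `ξ`, whose
oddness produces the relative sign in `U`. -/
lemma inv_rpow_neg_half {ξ : ℝ} (hξ : 0 < ξ) :
    (((ξ ^ (-(1 / 2) : ℝ) : ℝ) : ℂ))⁻¹ = ((ξ ^ (-(1 / 2) : ℝ) : ℝ) : ℂ) * ξ := by
  have h : (ξ ^ (-(1 / 2) : ℝ))⁻¹ = ξ ^ (-(1 / 2) : ℝ) * ξ := by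
    rw [← Real.rpow_neg hξ.le]
    conv_rhs => rw [← Real.rpow_one ξ, ← Real.rpow_mul hξ.le, ← Real.rpow_add hξ]
    norm_num
  exact_mod_cast h

end Monopole

end

/-! ### The expansions at the two endpoints -/

theorem theorem7p3 (k : ℝ) (hk0 : 0 < k) (hk1 : k < 1) (x₁ x₂ x₃ x₄ : ℝ)
    (ζ η : Fin 4 → ℂ) (hP : Monopole.IsAtiyahWardSolution k x₁ x₂ x₃ ζ η)
    (a : Fin 4 → ℂ) (ha : ∀ j, Monopole.IsAbelImage k (ζ j) (η j) (a j))
    (N : ℤ) (hN : ∑ j, a j = N * Monopole.tau k) (i : Fin 4) :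
    (∃! c : ℕ → Fin 2 × Fin 2 → ℂ, Monopole.HasPoleExpansion
      (fun ξ => Monopole.vBar k x₁ x₂ x₃ x₄ N ζ a i (1 - ξ)) c) ∧
    ∀ c : ℕ → Fin 2 × Fin 2 → ℂ,
      Monopole.HasPoleExpansion (fun ξ => Monopole.vBar k x₁ x₂ x₃ x₄ N ζ a i (1 - ξ)) c →
      Monopole.HasPoleExpansion (fun ξ => Monopole.vBar k x₁ x₂ x₃ x₄ N ζ a i (-1 + ξ))
        (fun s => -((-1 : ℂ) ^ s *
          Complex.exp (2 * Monopole.mu k x₁ x₂ x₃ x₄ N (ζ i) (a i))) •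
            Monopole.matU.mulVec (c s)) := by
  open Monopole in
  have hτ := tau_im_pos hk0 hk1
  obtain ⟨g, hg, hg0, hgeven, hgexp⟩ := exists_exp_halfInt hτ
  have ht : Filter.Tendsto (fun ξ : ℝ => (ξ : ℂ)) (𝓝[>] 0) (𝓝 0) :=
    (Complex.continuous_ofReal.tendsto' 0 0 (by simp)).mono_left nhdsWithin_le_nhds
  set L : ℂ → Fin 2 × Fin 2 → ℂ := lambdaBar k x₁ x₂ x₃ x₄ N ζ a i with hL
  have hΦ : AnalyticAt ℂ (columnGerm k g L) 0 :=
    analyticAt_columnGerm hτ hg (hg0 0) (differentiable_lambdaBar hτ x₁ x₂ x₃ x₄ N ζ a i)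
  refine poleExpansion_of_analyticAt hΦ _ _ ?_ ?_
  · filter_upwards [hgexp, self_mem_nhdsWithin] with ξ h hξ
    have hξ0 : (ξ : ℂ) ≠ 0 := by exact_mod_cast (ne_of_gt hξ)
    funext p
    obtain ⟨p, s⟩ := p
    rw [vBar_apply, Complex.exp_neg, h, mul_inv, inv_rpow_neg_half hξ, Complex.ofReal_sub,
      Complex.ofReal_one, theta2_one_sub_div_two, ← hL, ← rpow_neg_five_halves_mul_sq hξ]
    have hd : 1 / (ξ * thetaSlope k ξ) ^ 2 * (ξ : ℂ) ^ 2 = 1 / thetaSlope k ξ ^ 2 := by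
      field_simp
    fin_cases s <;> simp only [columnGerm, Pi.smul_apply, smul_eq_mul, ← hd] <;> simp <;> ring
  · filter_upwards [hgexp, self_mem_nhdsWithin, ht.eventually hgeven] with ξ h hξ hev
    have hξ0 : (ξ : ℂ) ≠ 0 := by exact_mod_cast (ne_of_gt hξ)
    have hz : -1 + ξ = -(1 - ξ) := by ring
    have hth : theta2 k (((-(1 - ξ) : ℝ) : ℂ) / 2) = ξ * thetaSlope k ξ := by
      rw [← theta2_one_sub_div_two, ← theta2_neg]
      push_cast
      ring_nf
    have hd : 1 / (ξ * thetaSlope k ξ) ^ 2 * (ξ : ℂ) ^ 2 = 1 / thetaSlope k ξ ^ 2 := by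
      field_simp
    funext p
    obtain ⟨p, s⟩ := p
    obtain ⟨h0, h1⟩ := lambdaBar_eq_add_two k x₁ x₂ x₃ x₄ N ζ a i ((-(1 - ξ) : ℝ) : ℂ) p
    -- The shift by `2` lands at the germ point of `Φ` with `ξ` replaced by `-ξ`.
    have harg : ((-(1 - ξ) : ℝ) : ℂ) + 2 = 1 - -(ξ : ℂ) := by push_cast; ring
    rw [harg] at h0 h1
    rw [hz, vBar_apply, halfInt_neg, neg_neg, Complex.exp_neg, h, mul_inv, inv_rpow_neg_half hξ,
      hth, h0, h1, ← hL, ← rpow_neg_five_halves_mul_sq hξ]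
    have hU : ∀ v : Fin 2 × Fin 2 → ℂ, matU.mulVec v (p, s) =
        (![v (p, 1), -v (p, 0)] : Fin 2 → ℂ) s := by
      intro v
      fin_cases p <;> fin_cases s <;>
        simp [matU, Matrix.mulVec, dotProduct, Fintype.sum_prod_type, Matrix.one_apply]
    rw [Pi.smul_apply, Pi.smul_apply, hU]
    fin_cases s <;>
      simp only [columnGerm, smul_eq_mul, thetaSlope_neg, hev, ← hd] <;> simp <;> ring
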